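/- Let $G$ be an abelian group with $|G|\le 2^{\mathfrak c}$, where $\mathfrak c=|\mathbb R|$, and let $X\subseteq G$. For $n\in\mathbb N=\{0,1,2,\dots\}$ put $G[n]=\{x\in G: nx=0\}$. The Zariski topology $\mathfrak Z_G$ on $G$ is the topology whose closed sets are the arbitrary intersections of finite (possibly empty) unions of sets of the form $g+G[n]$ with $g\in G$ and $n\in\mathbb N$. A topological group is called precompact if its completion is compact. Then the following conditions are equivalent: (i) $X$ is potentially dense in $G$, that is, there is a Hausdorff group topology $\mathcal T$ on $G$ such that $X$ is $\mathcal T$-dense in $G$; (ii) there is a precompact Hausdorff group topology $\mathcal T$ on $G$ such that $X$ is $\mathcal T$-dense in $G$; (iii) $X$ is Zariski dense in $G$, that is, the closure of $X$ in $\mathfrak Z_G$ is $G$. -/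

import Mathlib

open Topology

universe u

/-- The subgroup `G[n] = {x : n x = 0}`, as a set. For `n = 0` it is all of `G`. -/
def torsionSet (G : Type u) [AddCommGroup G] (n : ℕ) : Set G := {x : G | n • x = 0}

/-- Elementary algebraic sets: the sets `g + G[n]` with `g ∈ G` and `n ∈ ℕ` (`n = 0` allowed). -/
def IsElementaryAlgebraicSet {G : Type u} [AddCommGroup G] (A : Set G) : Prop :=
  ∃ (g : G) (n : ℕ), A = (fun x : G => g + x) '' torsionSet G n

/-- Finite unions of elementary algebraic sets (the empty union included). -/
def IsAdditivelyAlgebraicSet {G : Type u} [AddCommGroup G] (A : Set G) : Prop :=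
  ∃ 𝓔 : Set (Set G), 𝓔.Finite ∧ (∀ E ∈ 𝓔, IsElementaryAlgebraicSet E) ∧ A = ⋃₀ 𝓔

/-- Algebraic sets: arbitrary intersections of finite unions of elementary algebraic sets. -/
def IsAlgebraicSet {G : Type u} [AddCommGroup G] (A : Set G) : Prop :=
  ∃ 𝓐 : Set (Set G), (∀ B ∈ 𝓐, IsAdditivelyAlgebraicSet B) ∧ A = ⋂₀ 𝓐

theorem IsAdditivelyAlgebraicSet.union {G : Type u} [AddCommGroup G] {A B : Set G}
    (hA : IsAdditivelyAlgebraicSet A) (hB : IsAdditivelyAlgebraicSet B) :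
    IsAdditivelyAlgebraicSet (A ∪ B) := by
  obtain ⟨𝓔, h𝓔, h, rfl⟩ := hA
  obtain ⟨𝓕, h𝓕, h', rfl⟩ := hB
  refine ⟨𝓔 ∪ 𝓕, h𝓔.union h𝓕, ?_, (Set.sUnion_union 𝓔 𝓕).symm⟩
  rintro E (hE | hE)
  exacts [h E hE, h' E hE]

theorem IsAlgebraicSet.empty {G : Type u} [AddCommGroup G] : IsAlgebraicSet (∅ : Set G) := by
  refine ⟨{∅}, ?_, by simp⟩
  rintro B rfl
  exact ⟨∅, Set.finite_empty, by simp, by simp⟩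

theorem IsAlgebraicSet.union {G : Type u} [AddCommGroup G] {A B : Set G}
    (hA : IsAlgebraicSet A) (hB : IsAlgebraicSet B) : IsAlgebraicSet (A ∪ B) := by
  obtain ⟨𝓐, h, rfl⟩ := hA
  obtain ⟨𝓑, h', rfl⟩ := hB
  refine ⟨{C | ∃ a ∈ 𝓐, ∃ b ∈ 𝓑, C = a ∪ b}, ?_, ?_⟩
  · rintro C ⟨a, ha, b, hb, rfl⟩
    exact (h a ha).union (h' b hb)
  · ext x
    constructor
    · rintro hx C ⟨a, ha, b, hb, rfl⟩
      exact hx.imp (fun hx => hx a ha) (fun hx => hx b hb)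
    · intro hx
      by_contra hn
      simp only [Set.mem_union, Set.mem_sInter, not_or, not_forall] at hn
      obtain ⟨⟨a, ha, hxa⟩, ⟨b, hb, hxb⟩⟩ := hn
      rcases hx (a ∪ b) ⟨a, ha, b, hb, rfl⟩ with hx | hx
      exacts [hxa hx, hxb hx]

theorem IsAlgebraicSet.sInter {G : Type u} [AddCommGroup G] {𝓢 : Set (Set G)}
    (h : ∀ A ∈ 𝓢, IsAlgebraicSet A) : IsAlgebraicSet (⋂₀ 𝓢) := by
  refine ⟨{B | IsAdditivelyAlgebraicSet B ∧ ⋂₀ 𝓢 ⊆ B}, fun B hB => hB.1, ?_⟩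
  apply Set.Subset.antisymm
  · exact Set.subset_sInter fun B hB => hB.2
  · refine Set.subset_sInter fun A hA => ?_
    obtain ⟨𝓐, h𝓐, hAeq⟩ := h A hA
    rw [hAeq]
    refine Set.subset_sInter fun B hB => Set.sInter_subset_of_mem ⟨h𝓐 B hB, ?_⟩
    refine (Set.sInter_subset_of_mem hA).trans ?_
    rw [hAeq]
    exact Set.sInter_subset_of_mem hB

/-- The Zariski topology of an abelian group: its closed sets are the algebraic sets. -/
def zariskiTopology (G : Type u) [AddCommGroup G] : TopologicalSpace G :=
  TopologicalSpace.ofClosed {A : Set G | IsAlgebraicSet A} IsAlgebraicSet.empty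
    (fun _ h => IsAlgebraicSet.sInter fun _ hA => h hA)
    (fun _ hA _ hB => IsAlgebraicSet.union hA hB)

/-- `X` is Zariski dense in `G`: its closure in the Zariski topology is `G`. -/
def IsZariskiDense {G : Type u} [AddCommGroup G] (X : Set G) : Prop :=
  closure[zariskiTopology G] X = Set.univ

/-- `X` is potentially dense in `G`: it is dense in some Hausdorff group topology on `G`. -/
def IsPotentiallyDense {G : Type u} [AddCommGroup G] (X : Set G) : Prop :=
  ∃ (_ : TopologicalSpace G), IsTopologicalAddGroup G ∧ T2Space G ∧ Dense X

/-- A topological abelian group is precompact if its completion (with respect to its canonical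
group uniformity) is compact. -/
def IsPrecompactGroup (G : Type u) [AddCommGroup G] [TopologicalSpace G]
    [IsTopologicalAddGroup G] : Prop :=
  letI : UniformSpace G := IsTopologicalAddGroup.rightUniformSpace G
  CompactSpace (UniformSpace.Completion G)

/-! ### Closed algebraic sets, and precompact topologies induced from compact groups -/

section Topology

variable {G : Type u} [AddCommGroup G]

/-! Every Hausdorff group topology makes the sets g + G[n] closed, so potential density forces
Zariski density. For the converse, let n be the least positive integer with G[n] of finite index, or
0 if there is none. By B. H. Neumann's covering lemma, a Zariski dense X contains, in each of the
finitely many cosets of G[n], a translate of a sequence e in G[n] whose multiples d e_k are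
finite-to-one for every proper divisor d > 0 of n (`IsZariskiDense.exists_isDispersed`). Let T be
the circle. It suffices to find an injective homomorphism π from G to T^𝔠 such that the closure of
each {π(e_k)} contains the n-torsion of T^𝔠: then π(X) is dense in π(G), and the induced topology is
precompact.

Such a π is built in two steps. First, 𝔠 many characters are chosen by a Mycielski-type fusion in
the compact dual of G, so that density holds and the countable subgroup S spanned by the sequences
embeds (`exists_dense_hom`). The fusion rests on `IsDispersed.exists_small_character`: characters
small on a given finite set take almost arbitrary values in T[n] at a suitable e_k. Then only the
restriction to S is kept, and it is extended injectively to G by transfinite recursion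
(`exists_injective_extension`), where the bound 2^𝔠 leaves room for a good value at each step. -/

theorem isClosed_torsionSet [TopologicalSpace G] [IsTopologicalAddGroup G] [T2Space G] (n : ℕ) :
    IsClosed (torsionSet G n) :=
  isClosed_eq (continuous_nsmul n) continuous_const

theorem IsElementaryAlgebraicSet.isClosed [TopologicalSpace G] [IsTopologicalAddGroup G]
    [T2Space G] {A : Set G} (hA : IsElementaryAlgebraicSet A) : IsClosed A := by
  obtain ⟨g, n, rfl⟩ := hA
  exact (Homeomorph.addLeft g).isClosedMap _ (isClosed_torsionSet n)

theorem IsAdditivelyAlgebraicSet.isClosed [TopologicalSpace G] [IsTopologicalAddGroup G]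
    [T2Space G] {A : Set G} (hA : IsAdditivelyAlgebraicSet A) : IsClosed A := by
  obtain ⟨𝓔, hfin, h, rfl⟩ := hA
  rw [Set.sUnion_eq_biUnion]
  exact hfin.isClosed_biUnion fun E hE => (h E hE).isClosed

theorem isZariskiDense_iff {X : Set G} :
    IsZariskiDense X ↔ ∀ A, IsAdditivelyAlgebraicSet A → X ⊆ A → A = Set.univ := by
  have hcl : ∀ A : Set G, IsClosed[zariskiTopology G] A ↔ IsAlgebraicSet A := fun A => by
    rw [← @isOpen_compl_iff _ _ (zariskiTopology G)]
    change IsAlgebraicSet Aᶜᶜ ↔ _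
    rw [compl_compl]
  constructor
  · intro h A hA hXA
    have : IsClosed[zariskiTopology G] A :=
      (hcl A).2 ⟨{A}, by rintro B rfl; exact hA, by simp⟩
    exact Set.univ_subset_iff.1 (h ▸ @closure_minimal _ (zariskiTopology G) _ _ hXA this)
  · intro h
    obtain ⟨𝓐, h𝓐, h'⟩ := (hcl _).1 (@isClosed_closure _ (zariskiTopology G) X)
    rw [IsZariskiDense, h', Set.sInter_eq_univ]
    intro A hA
    refine h A (h𝓐 A hA) ?_
    refine (@subset_closure _ (zariskiTopology G) X).trans ?_
    rw [h']
    exact Set.sInter_subset_of_mem hA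

theorem IsPotentiallyDense.isZariskiDense {X : Set G} (h : IsPotentiallyDense X) :
    IsZariskiDense X := by
  obtain ⟨τ, _, _, hX⟩ := h
  refine isZariskiDense_iff.2 fun A hA hXA => ?_
  exact Set.univ_subset_iff.1 (hX.closure_eq ▸ closure_minimal hXA hA.isClosed)

theorem isPrecompactGroup_of_injective {K : Type*} [AddCommGroup K] [UniformSpace K]
    [IsUniformAddGroup K] [CompactSpace K] [T2Space K] (π : G →+ K)
    (hπ : Function.Injective π) {X : Set G} (hX : ∀ g, π g ∈ closure (π '' X)) :
    ∃ (_ : TopologicalSpace G) (_ : IsTopologicalAddGroup G),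
        T2Space G ∧ IsPrecompactGroup G ∧ Dense X := by
  let τ : TopologicalSpace G := TopologicalSpace.induced π inferInstance
  have hτ : IsTopologicalAddGroup G := topologicalAddGroup_induced π
  refine ⟨τ, hτ, ?_, ?_, ?_⟩
  · exact T2Space.of_injective_continuous hπ continuous_induced_dom
  -- The group uniformity is the one pulled back from K, so G inherits total boundedness and its
  -- completion is compact.
  · have key : IsTopologicalAddGroup.rightUniformSpace G = UniformSpace.comap π inferInstance := by
      let : UniformSpace G := UniformSpace.comap π inferInstance
      have : IsUniformAddGroup G := IsUniformAddGroup.comap π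
      exact IsUniformAddGroup.rightUniformSpace_eq
    let u : UniformSpace G := UniformSpace.comap π inferInstance
    change @CompactSpace (@UniformSpace.Completion G (IsTopologicalAddGroup.rightUniformSpace G)) _
    rw [key]
    have hi : IsUniformInducing π := ⟨rfl⟩
    have htb : TotallyBounded (Set.univ : Set G) := by
      have := (isCompact_univ (X := K)).totallyBounded
      have := totallyBounded_preimage hi this
      simpa using this
    have h2 : TotallyBounded (Set.univ : Set (UniformSpace.Completion G)) := by
      have := (htb.image (UniformSpace.Completion.uniformContinuous_coe G)).closure
      rwa [Set.image_univ, UniformSpace.Completion.denseRange_coe.closure_range] at this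
    exact ⟨isCompact_iff_totallyBounded_isComplete.2 ⟨h2, isComplete_univ⟩⟩
  · intro g
    rw [closure_induced]
    exact hX g

end Topology

/-! ### Fusion: selecting points with dense orbits in an uncountable product -/

section Mycielski

open Set Filter

theorem IsClopen.isLocallyConstant_mem {I : Type*} [TopologicalSpace I] {W : Set I}
    (hW : IsClopen W) : IsLocallyConstant (fun x => x ∈ W) := by
  rw [IsLocallyConstant.iff_eventually_eq]
  intro x
  by_cases hx : x ∈ W
  · filter_upwards [hW.isOpen.mem_nhds hx] with y hy
    simp [hx, hy]
  · filter_upwards [hW.isClosed.isOpen_compl.mem_nhds hx] with y hy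
    simp only [hx, eq_iff_iff, iff_false]
    exact hy

theorem IsLocallyConstant.finite_image_of_isCompact {I A : Type*} [TopologicalSpace I] {f : I → A}
    (hf : IsLocallyConstant f) {W : Set I} (hW : IsCompact W) : (f '' W).Finite := by
  let _ : TopologicalSpace A := ⊥
  have _ : DiscreteTopology A := ⟨rfl⟩
  exact (hW.image hf.continuous).finite_of_discrete

variable {I Y Z : Type*} [TopologicalSpace I] [TopologicalSpace Y] [TopologicalSpace Z]

/-- Simultaneous approximation: for finitely many pairs of nonempty open sets `(U, V)` some member
of the sequence `Φ` takes a value in `V` at a point of `U`, for all pairs at once. -/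
def HasFiniteHitting (Φ : ℕ → Y → Z) : Prop :=
  ∀ A : Set (Set Y × Set Z), A.Finite →
    (∀ a ∈ A, IsOpen a.1 ∧ a.1.Nonempty ∧ IsOpen a.2 ∧ a.2.Nonempty) →
    ∃ k, ∀ a ∈ A, ∃ y ∈ a.1, Φ k y ∈ a.2

/-- Locally constant families of closed sets with nonempty interior. -/
structure ClosedFamily (K : I → Set Y) : Prop where
  isLocallyConstant : IsLocallyConstant K
  isClosed : ∀ x, IsClosed (K x)
  nonempty : ∀ x, (interior (K x)).Nonempty

/-- One fusion step. Locally constant data take finitely many values on the compact set W, so finite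
hitting gives a single k for all of W; as W is clopen, changing K only there keeps it locally
constant. -/
theorem ClosedFamily.exists_refinement [RegularSpace Y] {Φ : ℕ → Y → Z}
    (hΦ : ∀ k, Continuous (Φ k)) (hit : HasFiniteHitting Φ) {K : I → Set Y} (hK : ClosedFamily K)
    {v : I → Set Z} (hv : IsLocallyConstant v) (hvo : ∀ x, IsOpen (v x))
    (hvn : ∀ x, (v x).Nonempty) {W : Set I} (hW : IsClopen W) (hWc : IsCompact W) :
    ∃ K' : I → Set Y, ClosedFamily K' ∧ (∀ x, K' x ⊆ K x) ∧
      ∃ k, ∀ x ∈ W, ∀ y ∈ K' x, Φ k y ∈ v x := by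
  classical
  obtain ⟨k, hk⟩ := hit ((fun x => (interior (K x), v x)) '' W)
    (((hK.isLocallyConstant.comp interior).prodMk hv).finite_image_of_isCompact hWc) (by
      rintro _ ⟨x, -, rfl⟩
      exact ⟨isOpen_interior, hK.nonempty x, hvo x, hvn x⟩)
  have key : ∀ a : Set Y × Set Z, ∃ N : Set Y, a ∈ (fun x => (interior (K x), v x)) '' W →
      IsClosed N ∧ (interior N).Nonempty ∧ N ⊆ a.1 ∧ ∀ y ∈ N, Φ k y ∈ a.2 := by
    intro a
    by_cases ha : a ∈ (fun x => (interior (K x), v x)) '' W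
    · obtain ⟨y, hy, hy'⟩ := hk a ha
      have hao : IsOpen a.1 ∧ IsOpen a.2 := by
        obtain ⟨x, -, rfl⟩ := ha
        exact ⟨isOpen_interior, hvo x⟩
      have hmem : a.1 ∩ Φ k ⁻¹' a.2 ∈ 𝓝 y :=
        (hao.1.inter (hao.2.preimage (hΦ k))).mem_nhds ⟨hy, hy'⟩
      obtain ⟨N, hN, hNc, hNs⟩ := exists_mem_nhds_isClosed_subset hmem
      exact ⟨N, fun _ => ⟨hNc, ⟨y, mem_interior_iff_mem_nhds.2 hN⟩, fun z hz => (hNs hz).1,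
        fun z hz => (hNs hz).2⟩⟩
    · exact ⟨∅, fun h => absurd h ha⟩
  choose N hN using key
  have hN' := fun x (hx : x ∈ W) => hN (interior (K x), v x) ⟨x, hx, rfl⟩
  refine ⟨fun x => if x ∈ W then N (interior (K x), v x) else K x, ⟨?_, ?_, ?_⟩, ?_, k, ?_⟩
  · exact (((hW.isLocallyConstant_mem).prodMk (hK.isLocallyConstant.prodMk hv)).comp
      fun t => if t.1 then N (interior t.2.1, t.2.2) else t.2.1)
  · intro x
    by_cases hx : x ∈ W
    · simpa [hx] using (hN' x hx).1
    · simpa [hx] using hK.isClosed x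
  · intro x
    by_cases hx : x ∈ W
    · simpa [hx] using (hN' x hx).2.1
    · simpa [hx] using hK.nonempty x
  · intro x
    by_cases hx : x ∈ W
    · simpa [hx] using (hN' x hx).2.2.1.trans interior_subset
    · simp [hx]
  · intro x hx y hy
    simp only [hx, if_true] at hy
    exact (hN' x hx).2.2.2 y hy

/-- Countably many requirements are met by successive shrinking, and compactness of Y supplies a
point in each intersection. They suffice for density in the product over all of I: a basic open set
constrains finitely many coordinates, and disjoint basic neighbourhoods of these turn it into one of
the requirements. -/
theorem ClosedFamily.exists_dense_selection [CompactSpace Y] [RegularSpace Y] [T2Space I]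
    [SecondCountableTopology Z] [Nonempty Z] {𝓑 : Set (Set I)} (h𝓑 : 𝓑.Countable)
    (hbasis : TopologicalSpace.IsTopologicalBasis 𝓑) (hclopen : ∀ C ∈ 𝓑, IsClopen C)
    (hcompact : ∀ C ∈ 𝓑, IsCompact C) {ι : Type*} [Countable ι]
    {Φ : ι → ℕ → Y → Z} (hΦ : ∀ i k, Continuous (Φ i k)) (hit : ∀ i, HasFiniteHitting (Φ i))
    {K : I → Set Y} (hK : ClosedFamily K) :
    ∃ y : I → Y, (∀ x, y x ∈ K x) ∧ ∀ i, DenseRange fun (k : ℕ) (x : I) => Φ i k (y x) := by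
  classical
  rcases isEmpty_or_nonempty ι with hι | hι
  · choose y hy using hK.nonempty
    exact ⟨y, fun x => interior_subset (hy x), fun i => hι.elim i⟩
  have _ : Countable 𝓑 := h𝓑
  obtain ⟨𝓥, h𝓥c, -, h𝓥⟩ := TopologicalSpace.exists_countable_basis Z
  have _ : Countable 𝓥 := h𝓥c
  -- The target at x is the intersection of those V whose partner C contains x. An R whose target is
  -- empty somewhere is skipped by the recursion.
  let v : Finset (𝓑 × 𝓥) → I → Set Z := fun R x => ⋂ p ∈ R, {z | x ∈ p.1.1 → z ∈ p.2.1}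
  let W : Finset (𝓑 × 𝓥) → Set I := fun R => ⋃ p ∈ R, p.1.1
  have hW : ∀ R, IsClopen (W R) := fun R => isClopen_biUnion_finset fun p _ => hclopen _ p.1.2
  have hWc : ∀ R, IsCompact (W R) := fun R => R.isCompact_biUnion fun p _ => hcompact _ p.1.2
  have hv : ∀ R, IsLocallyConstant (v R) := by
    intro R
    rw [IsLocallyConstant.iff_eventually_eq]
    intro x
    have : ∀ᶠ y in 𝓝 x, ∀ p ∈ R, (y ∈ p.1.1) = (x ∈ p.1.1) :=
      (Filter.eventually_all_finset R).2 fun p _ =>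
        (hclopen _ p.1.2).isLocallyConstant_mem.eventually_eq x
    filter_upwards [this] with y hy
    exact iInter₂_congr fun p hp => by rw [hy p hp]
  have hvo : ∀ R x, IsOpen (v R x) := by
    intro R x
    refine isOpen_biInter_finset fun p _ => ?_
    by_cases hx : x ∈ p.1.1
    · simpa [hx] using h𝓥.isOpen p.2.2
    · simp [hx]
  have step : ∀ (r : ι × Finset (𝓑 × 𝓥)) (K : {K : I → Set Y // ClosedFamily K}),
      ∃ K' : {K : I → Set Y // ClosedFamily K}, (∀ x, K'.1 x ⊆ K.1 x) ∧
        ((∀ x, (v r.2 x).Nonempty) → ∃ k, ∀ x ∈ W r.2, ∀ y ∈ K'.1 x, Φ r.1 k y ∈ v r.2 x) := by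
    rintro r ⟨K, hK⟩
    by_cases hn : ∀ x, (v r.2 x).Nonempty
    · obtain ⟨K', hK', hsub, h⟩ := hK.exists_refinement (hΦ r.1) (hit r.1) (hv r.2) (hvo r.2) hn
        (hW r.2) (hWc r.2)
      exact ⟨⟨K', hK'⟩, hsub, fun _ => h⟩
    · exact ⟨⟨K, hK⟩, fun _ => Subset.rfl, fun h => absurd h hn⟩
  choose next hnext hhit using step
  obtain ⟨r, hr⟩ := exists_surjective_nat (ι × Finset (𝓑 × 𝓥))
  let L : ℕ → {K : I → Set Y // ClosedFamily K} := fun N =>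
    Nat.rec ⟨K, hK⟩ (fun N K => next (r N) K) N
  have hmeet : ∀ x, (⋂ N, (L N).1 x).Nonempty := fun x =>
    IsCompact.nonempty_iInter_of_sequence_nonempty_isCompact_isClosed (fun N => (L N).1 x)
      (fun N => hnext (r N) (L N) x) (fun N => ((L N).2.nonempty x).mono interior_subset)
      ((L 0).2.isClosed x).isCompact (fun N => (L N).2.isClosed x)
  choose y hy using hmeet
  refine ⟨y, fun x => mem_iInter.1 (hy x) 0, fun i => ?_⟩
  rw [DenseRange, dense_iff_inter_open]
  rintro O hO ⟨f, hf⟩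
  obtain ⟨F, U, hU, hUO⟩ := isOpen_pi_iff.1 hO f hf
  have hV : ∀ x, ∃ V : 𝓥, x ∈ F → f x ∈ V.1 ∧ V.1 ⊆ U x := by
    intro x
    by_cases hx : x ∈ F
    · obtain ⟨V, hV, hfV, hVU⟩ := h𝓥.exists_subset_of_mem_open (hU x hx).2 (hU x hx).1
      exact ⟨⟨V, hV⟩, fun _ => ⟨hfV, hVU⟩⟩
    · obtain ⟨V, hV, -⟩ := h𝓥.exists_subset_of_mem_open (mem_univ (f x)) isOpen_univ
      exact ⟨⟨V, hV⟩, fun h => absurd h hx⟩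
  choose V hV using hV
  obtain ⟨D, hD, hdisj⟩ := F.finite_toSet.t2_separation
  have hC : ∀ x, ∃ C : 𝓑, x ∈ C.1 ∧ C.1 ⊆ D x := by
    intro x
    obtain ⟨C, hC, hxC, hCD⟩ := hbasis.exists_subset_of_mem_open (hD x).1 (hD x).2
    exact ⟨⟨C, hC⟩, hxC, hCD⟩
  choose C hC using hC
  let R : Finset (𝓑 × 𝓥) := F.image fun x => (C x, V x)
  have hRn : ∀ x, (v R x).Nonempty := by
    intro z
    by_cases hz : ∃ x ∈ F, z ∈ (C x).1
    · obtain ⟨x, hx, hzx⟩ := hz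
      refine ⟨f x, mem_iInter₂.2 fun p hp hzp => ?_⟩
      obtain ⟨x', hx', rfl⟩ := Finset.mem_image.1 hp
      have : x = x' := by
        by_contra hne
        exact Set.disjoint_left.1 (hdisj hx hx' hne) ((hC x).2 hzx) ((hC x').2 hzp)
      exact this ▸ (hV x hx).1
    · obtain ⟨w⟩ := ‹Nonempty Z›
      refine ⟨w, mem_iInter₂.2 fun p hp hzp => ?_⟩
      obtain ⟨x', hx', rfl⟩ := Finset.mem_image.1 hp
      exact absurd ⟨x', hx', hzp⟩ hz
  obtain ⟨N, hN⟩ := hr (i, R)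
  obtain ⟨k, hk⟩ := hhit (r N) (L N) (by rw [hN]; exact hRn)
  refine ⟨_, hUO ?_, k, rfl⟩
  intro x hx
  have hxR : (C x, V x) ∈ R := Finset.mem_image_of_mem _ hx
  have h1 := hk x (by rw [hN]; exact mem_iUnion₂.2 ⟨_, hxR, (hC x).1⟩) (y x)
    (mem_iInter.1 (hy x) (N + 1))
  rw [hN] at h1
  exact (hV x hx).2 (mem_iInter₂.1 h1 _ hxR (hC x).1)

theorem exists_countable_compact_clopen_basis :
    ∃ 𝓑 : Set (Set (ℕ × (ℕ → Bool))), 𝓑.Countable ∧ TopologicalSpace.IsTopologicalBasis 𝓑 ∧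
      (∀ C ∈ 𝓑, IsClopen C) ∧ ∀ C ∈ 𝓑, IsCompact C := by
  have hcl : {s : Set (ℕ → Bool) | IsClopen s}.Countable := by
    have : Countable (TopologicalSpace.Clopens (ℕ → Bool)) :=
      TopologicalSpace.Clopens.countable_iff_secondCountable.2 inferInstance
    refine (countable_range fun s : TopologicalSpace.Clopens (ℕ → Bool) => s.1).mono ?_
    intro s hs
    exact ⟨⟨s, hs⟩, rfl⟩
  refine ⟨_, ?_, (isTopologicalBasis_singletons ℕ).prod isTopologicalBasis_isClopen, ?_, ?_⟩
  · refine Countable.image2 ?_ hcl _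
    refine (countable_range fun n : ℕ => ({n} : Set ℕ)).mono ?_
    rintro _ ⟨n, rfl⟩
    exact ⟨n, rfl⟩
  · rintro _ ⟨s, -, t, ht, rfl⟩
    exact (isClopen_discrete s).prod ht
  · rintro _ ⟨_, ⟨n, rfl⟩, t, ht, rfl⟩
    exact isCompact_singleton.prod ht.isClosed.isCompact

end Mycielski

/-! ### Injective extension of homomorphisms by transfinite recursion -/

section Extension

open Set

theorem UnitAddCircle.exists_addOrderOf_eq (m : ℕ) : ∃ t : UnitAddCircle, addOrderOf t = m := by
  rcases Nat.eq_zero_or_pos m with rfl | hm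
  · refine ⟨((√2 : ℝ) : UnitAddCircle), addOrderOf_eq_zero_iff.2 fun h => ?_⟩
    obtain ⟨q, hq⟩ := AddCircle.isOfFinAddOrder_iff_exists_rat_eq_div.1 h
    exact irrational_sqrt_two ⟨q, by simpa using hq⟩
  · exact ⟨_, AddCircle.addOrderOf_period_div (p := (1 : ℝ)) hm⟩

/-- A subgroup of a product that is the graph of an isomorphism between its two projections. -/
def AddSubgroup.IsBiinjective {G K : Type*} [AddCommGroup G] [AddCommGroup K]
    (Γ : AddSubgroup (G × K)) : Prop :=
  ∀ p ∈ Γ, p.1 = 0 ↔ p.2 = 0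

theorem AddSubgroup.IsBiinjective.mono {G K : Type*} [AddCommGroup G] [AddCommGroup K]
    {Γ Δ : AddSubgroup (G × K)} (h : Δ.IsBiinjective) (hle : Γ ≤ Δ) : Γ.IsBiinjective :=
  fun p hp => h p (hle hp)

/-- Let m be the order of a modulo the domain of Γ. Candidates for the value at a are v₀ + t·1_A,
with m v₀ prescribed, t of order exactly m and A ⊆ I. A failing A yields k not divisible by m and an
element of Γ with second coordinate -k(v₀ + t·1_A); since kt ≠ 0, this pair determines A. Hence if
all A failed, Set I would embed in ℤ × Γ. -/
theorem AddSubgroup.IsBiinjective.exists_sup_zmultiples {G I : Type u} [AddCommGroup G]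
    [Infinite I] {Γ : AddSubgroup (G × (I → UnitAddCircle))} (hΓ : Γ.IsBiinjective)
    (hcard : Cardinal.mk Γ < Cardinal.mk (Set I)) (a : G) :
    ∃ v : I → UnitAddCircle, (Γ ⊔ AddSubgroup.zmultiples (a, v)).IsBiinjective := by
  classical
  let D : AddSubgroup G := Γ.map (AddMonoidHom.fst G (I → UnitAddCircle))
  let m := addOrderOf (a : G ⧸ D)
  have hm : ∀ k : ℤ, k • a ∈ D ↔ (m : ℤ) ∣ k := by
    intro k
    rw [addOrderOf_dvd_iff_zsmul_eq_zero, ← QuotientAddGroup.mk_zsmul,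
      QuotientAddGroup.eq_zero_iff]
  obtain ⟨⟨_, w⟩, hw, rfl : _ = (m : ℤ) • a⟩ := (hm m).2 dvd_rfl
  obtain ⟨v₀, hv₀⟩ : ∃ v₀ : I → UnitAddCircle, (m : ℤ) • v₀ = w := by
    -- Division by m is impossible when m = 0, but then w = 0 by biinjectivity.
    by_cases h0 : (m : ℤ) = 0
    · refine ⟨0, ?_⟩
      have := (hΓ _ hw).1 (by simp [h0])
      rw [smul_zero]
      exact this.symm
    · refine ⟨fun i => DivisibleBy.div (w i) (m : ℤ), funext fun i => ?_⟩
      exact DivisibleBy.div_cancel (w i) h0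
  obtain ⟨t, ht⟩ := UnitAddCircle.exists_addOrderOf_eq m
  let v : Set I → I → UnitAddCircle := fun A => v₀ + A.indicator fun _ => t
  have hmv : ∀ A, (m : ℤ) • v A = w := by
    intro A
    have : (m : ℤ) • A.indicator (fun _ => t) = 0 := by
      funext i
      by_cases hi : i ∈ A <;> simp [hi, ← ht, addOrderOf_nsmul_eq_zero]
    simp only [v, smul_add, hv₀, this, add_zero]
  have hdvd : ∀ A (k : ℤ), (m : ℤ) ∣ k → k • (a, v A) ∈ Γ := by
    rintro A _ ⟨j, rfl⟩
    rw [mul_comm, mul_smul]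
    refine Γ.zsmul_mem ?_ j
    have : (m : ℤ) • (a, v A) = ((m : ℤ) • a, w) := by rw [Prod.smul_mk, hmv]
    rw [this]
    exact hw
  by_contra! hcon
  have key : ∀ A : Set I, ∃ q : ℤ × Γ, ¬ (m : ℤ) ∣ q.1 ∧ q.2.1.2 = - (q.1 • v A) := by
    intro A
    have hA := hcon (v A)
    rw [AddSubgroup.IsBiinjective] at hA
    push Not at hA
    obtain ⟨p, hp, hne⟩ := hA
    obtain ⟨γ, hγ, z, hz, rfl⟩ := AddSubgroup.mem_sup.1 hp
    obtain ⟨k, rfl⟩ := AddSubgroup.mem_zmultiples_iff.1 hz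
    have hk : ¬ (m : ℤ) ∣ k := fun hk => by
      have := hΓ _ (Γ.add_mem hγ (hdvd A k hk))
      tauto
    refine ⟨(k, ⟨γ, hγ⟩), hk, ?_⟩
    have h1 : ¬ (γ + k • (a, v A)).1 = 0 := by
      intro h
      refine hk ((hm k).1 ?_)
      have : k • a = - γ.1 := by
        rw [eq_neg_iff_add_eq_zero, add_comm]
        simpa using h
      rw [this]
      exact D.neg_mem ⟨γ, hγ, rfl⟩
    have h2 : (γ + k • (a, v A)).2 = 0 := by tauto
    rw [eq_neg_iff_add_eq_zero]
    simpa using h2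
  choose f hf hf' using key
  have hinj : Function.Injective f := by
    intro A B hAB
    have h1 : (f A).1 • v A = (f A).1 • v B := by
      have := hf' A
      rw [hAB, hf' B, neg_inj] at this
      rw [hAB]
      exact this.symm
    have h2 : ∀ i, (f A).1 • A.indicator (fun _ => t) i = (f A).1 • B.indicator (fun _ => t) i := by
      intro i
      have := congrFun h1 i
      simpa [v, smul_add] using this
    have h3 : (f A).1 • t ≠ 0 := fun h => hf A (ht ▸ addOrderOf_dvd_iff_zsmul_eq_zero.2 h)
    ext i
    have := h2 i
    by_cases hA : i ∈ A <;> by_cases hB : i ∈ B <;> simp_all [eq_comm]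
  have hle := Cardinal.mk_le_of_injective hinj
  refine hle.not_gt ?_
  have haleph : Cardinal.aleph0 < Cardinal.mk (Set I) := by
    rw [Cardinal.mk_set]
    exact (Cardinal.aleph0_le_mk I).trans_lt (Cardinal.cantor _)
  rw [Cardinal.mk_prod]
  refine Cardinal.mul_lt_of_lt haleph.le ?_ ?_
  · simpa using haleph
  · simpa using hcard

theorem AddSubgroup.cardinalMk_closure_le {A : Type u} [AddCommGroup A] (s : Set A) :
    Cardinal.mk (AddSubgroup.closure s) ≤ max (Cardinal.mk s) Cardinal.aleph0 := by
  rcases s.eq_empty_or_nonempty with rfl | hs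
  · simp
  have _ : Nonempty s := hs.to_subtype
  rw [← Cardinal.mk_freeAbelianGroup]
  have hle : AddSubgroup.closure s ≤ (FreeAbelianGroup.lift ((↑) : s → A)).range := by
    rw [AddSubgroup.closure_le]
    intro x hx
    exact ⟨FreeAbelianGroup.of ⟨x, hx⟩, by simp⟩
  exact (Cardinal.mk_le_mk_of_subset hle).trans Cardinal.mk_range_le

/-- G is well-ordered in the order type of its cardinal, so fewer than |G| values are fixed before
each step and the graph so far is smaller than Set I. -/
theorem exists_injective_extension {G I : Type u} [AddCommGroup G] [Infinite I]
    (hG : Cardinal.mk G ≤ Cardinal.mk (Set I)) {Γ₀ : AddSubgroup (G × (I → UnitAddCircle))}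
    (hΓ₀ : Γ₀.IsBiinjective) (hcount : (Γ₀ : Set (G × (I → UnitAddCircle))).Countable) :
    ∃ π : G →+ (I → UnitAddCircle), Function.Injective π ∧ ∀ p ∈ Γ₀, π p.1 = p.2 := by
  classical
  obtain ⟨r, hwo, hr⟩ := Cardinal.exists_ord_eq G
  let gen : (G → I → UnitAddCircle) → Set G → AddSubgroup (G × (I → UnitAddCircle)) :=
    fun y P => AddSubgroup.closure (Γ₀ ∪ (fun b => (b, y b)) '' P)
  have gen_mono : ∀ y {P Q : Set G}, P ⊆ Q → gen y P ≤ gen y Q := fun y P Q h =>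
    AddSubgroup.closure_mono (union_subset_union_right _ (image_mono h))
  have gen_mem : ∀ y {P : Set G} {b}, b ∈ P → (b, y b) ∈ gen y P := fun y P b hb =>
    AddSubgroup.subset_closure (Or.inr ⟨b, hb, rfl⟩)
  have gen_base : ∀ y {P : Set G}, Γ₀ ≤ gen y P := fun y P p hp =>
    AddSubgroup.subset_closure (Or.inl hp)
  have gen_congr : ∀ {y y' : G → I → UnitAddCircle} {P : Set G}, (∀ b ∈ P, y b = y' b) →
      gen y P = gen y' P := fun h => by
    simp only [gen]
    rw [image_congr fun b hb => by rw [h b hb]]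
  -- Biinjectivity is assumed inside the existential, so the recursion runs unconditionally; it is
  -- established afterwards by induction.
  have hext : ∀ (a : G) (y : (b : G) → r b a → I → UnitAddCircle), ∃ v : I → UnitAddCircle,
      (gen (fun b => if h : r b a then y b h else 0) {b | r b a}).IsBiinjective →
      (gen (fun b => if h : r b a then y b h else 0) {b | r b a} ⊔
        AddSubgroup.zmultiples (a, v)).IsBiinjective := by
    intro a y
    by_cases hb : (gen (fun b => if h : r b a then y b h else 0) {b | r b a}).IsBiinjective
    swap
    · exact ⟨0, fun h => absurd h hb⟩
    have haleph : Cardinal.aleph0 < Cardinal.mk (Set I) := by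
      rw [Cardinal.mk_set]
      exact (Cardinal.aleph0_le_mk I).trans_lt (Cardinal.cantor _)
    obtain ⟨v, hv⟩ := hb.exists_sup_zmultiples (by
      refine (AddSubgroup.cardinalMk_closure_le _).trans_lt (max_lt ?_ haleph)
      refine (Cardinal.mk_union_le _ _).trans_lt (Cardinal.add_lt_of_lt haleph.le ?_ ?_)
      · exact (Cardinal.le_aleph0_iff_set_countable.2 hcount).trans_lt haleph
      · refine Cardinal.mk_image_le.trans_lt ?_
        exact (Cardinal.card_typein_lt a hr).trans_le hG) a
    exact ⟨v, fun _ => hv⟩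
  choose F hF using hext
  let y : G → I → UnitAddCircle := hwo.wf.fix F
  have hy : ∀ a, (gen y {b | r b a}).IsBiinjective →
      (gen y {b | r b a} ⊔ AddSubgroup.zmultiples (a, y a)).IsBiinjective := by
    intro a
    have h1 := hF a fun b _ => y b
    have h0 : gen (fun b => if _ : r b a then y b else 0) {b | r b a} = gen y {b | r b a} :=
      gen_congr fun b hb => dif_pos hb
    rw [h0] at h1
    have h2 : y a = F a fun b _ => y b := hwo.wf.fix_eq F a
    rwa [h2]
  have hlim : ∀ P : Set G, (∀ b ∈ P, (gen y {c | r c b ∨ c = b}).IsBiinjective) →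
      (gen y P).IsBiinjective := by
    intro P hP
    -- The stages form a chain, so each element of the generated group already lies in a single
    -- stage.
    have : ∀ p ∈ gen y P, p ∈ Γ₀ ∨ ∃ b ∈ P, p ∈ gen y {c | r c b ∨ c = b} := by
      intro p hp
      induction hp using AddSubgroup.closure_induction with
      | mem p hp =>
        rcases hp with hp | ⟨b, hb, rfl⟩
        · exact Or.inl hp
        · exact Or.inr ⟨b, hb, gen_mem y (Or.inr rfl)⟩
      | zero => exact Or.inl Γ₀.zero_mem
      | neg p _ h =>
        rcases h with h | ⟨b, hb, h⟩
        · exact Or.inl (Γ₀.neg_mem h)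
        · exact Or.inr ⟨b, hb, AddSubgroup.neg_mem _ h⟩
      | add p q _ _ hp hq =>
        rcases hp with hp | ⟨b, hb, hp⟩ <;> rcases hq with hq | ⟨c, hc, hq⟩
        · exact Or.inl (Γ₀.add_mem hp hq)
        · exact Or.inr ⟨c, hc, AddSubgroup.add_mem _ (gen_base y hp) hq⟩
        · exact Or.inr ⟨b, hb, AddSubgroup.add_mem _ hp (gen_base y hq)⟩
        · have hmono : ∀ {b c : G}, r b c → gen y {d | r d b ∨ d = b} ≤ gen y {d | r d c ∨ d = c} :=
            fun {b c} hbc => gen_mono y fun d hd => by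
              rcases hd with hd | rfl
              · exact Or.inl (_root_.trans hd hbc)
              · exact Or.inl hbc
          rcases trichotomous_of r b c with h | rfl | h
          · exact Or.inr ⟨c, hc, AddSubgroup.add_mem _ (hmono h hp) hq⟩
          · exact Or.inr ⟨b, hb, AddSubgroup.add_mem _ hp hq⟩
          · exact Or.inr ⟨b, hb, AddSubgroup.add_mem _ hp (hmono h hq)⟩
    intro p hp
    rcases this p hp with h | ⟨b, hb, h⟩
    · exact hΓ₀ p h
    · exact hP b hb p h
  have hstage : ∀ a, (gen y {c | r c a ∨ c = a}).IsBiinjective := by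
    intro a
    induction a using hwo.wf.induction with
    | _ a ih =>
      refine (hy a (hlim _ ih)).mono ?_
      refine (AddSubgroup.closure_le _).2 ?_
      rintro p (hp | ⟨c, hc | rfl, rfl⟩)
      · exact le_sup_left (a := gen y {b | r b a}) (gen_base y hp)
      · exact le_sup_left (a := gen y {b | r b a}) (gen_mem y hc)
      · exact le_sup_right (a := gen y {b | r b c}) (AddSubgroup.mem_zmultiples _)
  have hall : (gen y univ).IsBiinjective := hlim univ fun b _ => hstage b
  have hfun : ∀ p ∈ gen y univ, y p.1 = p.2 := by
    intro p hp
    have := (hall _ (AddSubgroup.sub_mem _ (gen_mem y (mem_univ p.1)) hp)).1 (by simp)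
    exact sub_eq_zero.1 this
  refine ⟨AddMonoidHom.mk' y fun a b => ?_, ?_, fun p hp => hfun p (gen_base y hp)⟩
  · exact hfun _ (AddSubgroup.add_mem _ (gen_mem y (mem_univ a)) (gen_mem y (mem_univ b)))
  · rw [injective_iff_map_eq_zero]
    intro a ha
    exact (hall _ (gen_mem y (mem_univ a))).2 ha

end Extension

/-! ### Characters with prescribed behaviour on a finite set and on a sequence -/

section Characters

open Set

variable {G : Type*} [AddCommGroup G]

theorem AddSubgroup.exists_extension {Q : Type*} [AddCommGroup Q] [DivisibleBy Q ℤ]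
    (L : AddSubgroup G) (α : L →+ Q) : ∃ ξ : G →+ Q, ∀ s : L, ξ s = α s := by
  obtain ⟨ξ, hξ⟩ := (Module.Baer.of_divisible Q).extension_property_addMonoidHom L.subtype
    L.subtype_injective α
  exact ⟨ξ, fun s => DFunLike.congr_fun hξ s⟩

theorem exists_hom_apply_eq {Q : Type*} [AddCommGroup Q] [DivisibleBy Q ℤ] {x : G} {t : Q}
    (h : ∀ c : ℤ, c • x = 0 → c • t = 0) : ∃ ξ : G →+ Q, ξ x = t := by
  let f : G →ₗ.[ℤ] Q := LinearPMap.mkSpanSingleton' x t h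
  obtain ⟨ξ, hξ⟩ := f.domain.toAddSubgroup.exists_extension f.toFun.toAddMonoidHom
  have hx : x ∈ f.domain := Submodule.mem_span_singleton_self x
  exact ⟨ξ, (hξ ⟨x, hx⟩).trans (LinearPMap.mkSpanSingleton'_apply_self x t h hx)⟩

theorem AddSubgroup.exists_hom_vanishing {Q : Type*} [AddCommGroup Q] [DivisibleBy Q ℤ]
    (L : AddSubgroup G) {x : G} {t : Q} (h : ∀ c : ℤ, c • x ∈ L → c • t = 0) :
    ∃ ξ : G →+ Q, (∀ s ∈ L, ξ s = 0) ∧ ξ x = t := by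
  obtain ⟨ξ, hξ⟩ := exists_hom_apply_eq (x := (x : G ⧸ L)) (t := t) fun c hc => h c <| by
    rwa [← QuotientAddGroup.mk_zsmul, QuotientAddGroup.eq_zero_iff] at hc
  refine ⟨ξ.comp (QuotientAddGroup.mk' L), fun s hs => ?_, hξ⟩
  simp [(QuotientAddGroup.eq_zero_iff s).2 hs]

/-- The coordinates of the free part suffice because the torsion part is finite. -/
theorem AddGroup.FG.exists_coordinates (L : Type*) [AddCommGroup L] [AddGroup.FG L] :
    ∃ (r : ℕ) (c : Fin r → (L →+ ℤ)), ∀ B : ℤ, {w : L | ∀ i, |c i w| ≤ B}.Finite := by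
  obtain ⟨r, ι, _, p, hp, e, ⟨φ⟩⟩ := AddCommGroup.equiv_free_prod_directSum_zmod L
  have _ : ∀ i, NeZero (p i ^ e i) := fun i => ⟨pow_ne_zero _ (hp i).ne_zero⟩
  have hfin : Finite (DirectSum ι fun i => ZMod (p i ^ e i)) := by
    classical
    exact Finite.of_equiv _ (DFinsupp.equivFunOnFintype (β := fun i => ZMod (p i ^ e i))).symm
  refine ⟨r, fun i => (Finsupp.applyAddHom i).comp ((AddMonoidHom.fst _ _).comp φ.toAddMonoidHom),
    fun B => ?_⟩
  have h1 : ((Icc (fun _ : Fin r => -B) (fun _ => B)) ×ˢ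
      (univ : Set (DirectSum ι fun i => ZMod (p i ^ e i)))).Finite :=
    (finite_Icc _ _).prod finite_univ
  refine (h1.preimage (f := fun w : L => (((φ w).1 : Fin r → ℤ), (φ w).2)) ?_).subset ?_
  · intro w _ w' _ h
    simp only [Prod.mk.injEq, DFunLike.coe_fn_eq] at h
    exact φ.injective (Prod.ext h.1 h.2)
  · intro w hw
    exact ⟨⟨fun i => (abs_le.1 (hw i)).1, fun i => (abs_le.1 (hw i)).2⟩, mem_univ _⟩

theorem AddGroup.FG.finite_torsion (L : Type*) [AddCommGroup L] [AddGroup.FG L] {n : ℕ}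
    (hn : 0 < n) : {w : L | n • w = 0}.Finite := by
  obtain ⟨r, c, hc⟩ := AddGroup.FG.exists_coordinates L
  refine (hc 0).subset fun w (hw : n • w = 0) i => ?_
  have : n • c i w = 0 := by rw [← map_nsmul, hw, map_zero]
  simp [(smul_eq_zero.1 this).resolve_left hn.ne']

theorem UnitAddCircle.norm_coe_le (x : ℝ) : ‖(x : UnitAddCircle)‖ ≤ |x| := 
  QuotientAddGroup.norm_mk_le_norm

theorem UnitAddCircle.exists_zsmul_eq_zero_near {m : ℕ} (hm : 0 < m) (t : UnitAddCircle) :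
    ∃ t' : UnitAddCircle, (m : ℤ) • t' = 0 ∧ ‖t' - t‖ ≤ 1 / m := by
  obtain ⟨x, rfl⟩ := QuotientAddGroup.mk_surjective t
  have hm' : (0 : ℝ) < m := by exact_mod_cast hm
  refine ⟨((⌊m * x⌋ / m : ℝ) : UnitAddCircle), ?_, ?_⟩
  · rw [← AddCircle.coe_zsmul, AddCircle.coe_eq_zero_iff]
    exact ⟨⌊m * x⌋, by simp; field_simp⟩
  · refine (UnitAddCircle.norm_coe_le (⌊m * x⌋ / m - x)).trans ?_
    have h1 := Int.floor_le (m * x)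
    have h2 := Int.lt_floor_add_one (m * x)
    have : (⌊m * x⌋ / m - x : ℝ) = - ((m * x - ⌊m * x⌋) / m) := by field_simp; ring
    rw [this, abs_neg, abs_of_nonneg (div_nonneg (by linarith) hm'.le)]
    gcongr
    linarith

/-- The sequence `e` in `G[n]` has finite-to-one multiples by all proper divisors of `n`. -/
structure IsDispersed (n : ℕ) (e : ℕ → G) : Prop where
  nsmul_eq_zero : ∀ k, n • e k = 0
  finite_fiber : ∀ d, 0 < d → d ∣ n → d ≠ n → ∀ h, {k | d • e k = h}.Finite

/-- Otherwise each k has a proper divisor d of n with d e_k in the finite group L[n], and finitely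
many finite fibres would cover ℕ. -/
theorem IsDispersed.exists_order_eq {n : ℕ} {e : ℕ → G} (he : IsDispersed n e) (hn : 0 < n)
    (L : AddSubgroup G) [AddGroup.FG L] : ∃ k, addOrderOf (e k : G ⧸ L) = n := by
  by_contra! hcon
  have hT := (AddGroup.FG.finite_torsion L hn).image ((↑) : L → G)
  have hfin : (⋃ d ∈ n.properDivisors, ⋃ h ∈ ((↑) : L → G) '' {w : L | n • w = 0},
      {k | d • e k = h}).Finite := by
    refine n.properDivisors.finite_toSet.biUnion fun d hd => hT.biUnion fun h _ => ?_
    have hd' := Nat.mem_properDivisors.1 hd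
    exact he.finite_fiber d (Nat.pos_of_dvd_of_pos hd'.1 hn) hd'.1 hd'.2.ne h
  refine infinite_univ (hfin.subset fun k _ => ?_)
  have hdvd : addOrderOf (e k : G ⧸ L) ∣ n := by
    rw [addOrderOf_dvd_iff_nsmul_eq_zero, ← QuotientAddGroup.mk_nsmul, he.nsmul_eq_zero]
    rfl
  have hmem : addOrderOf (e k : G ⧸ L) • e k ∈ L := by
    rw [← QuotientAddGroup.eq_zero_iff, QuotientAddGroup.mk_nsmul, addOrderOf_nsmul_eq_zero]
  refine mem_iUnion₂.2 ⟨_, Nat.mem_properDivisors.2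
    ⟨hdvd, (Nat.le_of_dvd hn hdvd).lt_of_ne (hcon k)⟩, mem_iUnion₂.2 ⟨_, ⟨⟨_, hmem⟩, ?_, rfl⟩, rfl⟩⟩
  refine Subtype.ext ?_
  change n • addOrderOf (e k : G ⧸ L) • e k = 0
  rw [smul_comm, he.nsmul_eq_zero, smul_zero]

/-- The elements N e_k form a finite-to-one sequence in a finitely generated group, so some integer
coordinate is large at some N e_k while bounded on F. Rescaling that coordinate and extending it to
G, as ℝ is divisible, gives α. -/
theorem IsDispersed.exists_real_hom {e : ℕ → G} (he : IsDispersed 0 e) (F : Finset G) {N : ℕ}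
    (hN : 0 < N) (hmem : ∀ k, N • e k ∈ AddSubgroup.closure (F : Set G)) {ε : ℝ} (hε : 0 < ε) :
    ∃ k, ∀ x ∈ Ico (0 : ℝ) 1, ∃ α : G →+ ℝ, (∀ s ∈ F, |α s| < ε) ∧ α (e k) = x := by
  have _ : AddGroup.FG (AddSubgroup.closure (F : Set G)) :=
    (AddGroup.fg_iff_addSubgroup_fg _).2 ⟨F, rfl⟩
  obtain ⟨r, c, hc⟩ := AddGroup.FG.exists_coordinates (AddSubgroup.closure (F : Set G))
  let F' : F → AddSubgroup.closure (F : Set G) := fun s => ⟨s, AddSubgroup.subset_closure s.2⟩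
  obtain ⟨C, hC⟩ : ∃ C : ℤ, ∀ i s, |c i (F' s)| ≤ C := by
    obtain ⟨C, hC⟩ := (finite_range fun q : Fin r × F => |c q.1 (F' q.2)|).bddAbove
    exact ⟨C, fun i s => hC ⟨(i, s), rfl⟩⟩
  -- With scaling factor N x / c_i(N e_k), values on F are at most N C / |c_i(N e_k)|, which this
  -- threshold makes less than ε.
  obtain ⟨B, hB⟩ := exists_int_gt (N * (|C| + 1) / ε)
  let w : ℕ → AddSubgroup.closure (F : Set G) := fun k => ⟨N • e k, hmem k⟩
  obtain ⟨k, i, hki⟩ : ∃ k i, B < |c i (w k)| := by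
    by_contra! hcon
    refine infinite_univ (((hc B).preimage' (f := w) fun h _ => ?_).subset fun k _ => hcon k)
    refine (he.finite_fiber N hN (dvd_zero N) hN.ne' h).subset fun k hk => ?_
    exact congrArg Subtype.val (mem_singleton_iff.1 hk)
  refine ⟨k, fun x hx => ?_⟩
  have hNpos : (0 : ℝ) < N := by exact_mod_cast hN
  have hpos : (0 : ℝ) < N * (|C| + 1) / ε := by positivity
  have hcw : N * (|C| + 1) / ε < |(c i (w k) : ℝ)| := hB.trans (by exact_mod_cast hki)
  have hcw0 : (c i (w k) : ℝ) ≠ 0 := abs_pos.1 (hpos.trans hcw)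
  obtain ⟨α, hα⟩ := (AddSubgroup.closure (F : Set G)).exists_extension
    ((AddMonoidHom.mulLeft (N * x / c i (w k) : ℝ)).comp ((Int.castAddHom ℝ).comp (c i)))
  refine ⟨α, fun s hs => ?_, ?_⟩
  · have h1 : α s = N * x / c i (w k) * c i (F' ⟨s, hs⟩) := hα (F' ⟨s, hs⟩)
    have h2 : |(c i (F' ⟨s, hs⟩) : ℝ)| < |C| + 1 := by
      have : |(c i (F' ⟨s, hs⟩) : ℝ)| ≤ C := by exact_mod_cast hC i ⟨s, hs⟩
      rw [Int.cast_abs]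
      exact (this.trans (le_abs_self _)).trans_lt (lt_add_one _)
    rw [div_lt_iff₀ hε] at hcw
    rw [h1, abs_mul, abs_div, abs_mul, abs_of_nonneg hx.1, abs_of_pos hNpos, div_mul_eq_mul_div,
      div_lt_iff₀ (abs_pos.2 hcw0)]
    have h3 : N * x * |(c i (F' ⟨s, hs⟩) : ℝ)| ≤ N * (|C| + 1) := by
      have := hx.1
      have h4 : N * x ≤ N * 1 := by gcongr; exact hx.2.le
      rw [mul_one] at h4
      exact mul_le_mul h4 h2.le (abs_nonneg _) hNpos.le
    linarith
  · have h1 : α (N • e k) = N * x / c i (w k) * c i (w k) := hα (w k)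
    rw [map_nsmul, div_mul_cancel₀ _ hcw0, nsmul_eq_mul] at h1
    exact mul_left_cancel₀ hNpos.ne' h1

/-- For n > 0, or when e_k has infinite or large order modulo L = ⟨F⟩, a character vanishing on L
does it, since the m-torsion of the circle is 1/m-dense. Otherwise n = 0 and all orders are at most
M, so M! e_k ∈ L and a real homomorphism is used. That k precedes t lets one k serve many targets at
once. -/
theorem IsDispersed.exists_small_character {n : ℕ} {e : ℕ → G} (he : IsDispersed n e)
    (F : Finset G) {ε : ℝ} (hε : 0 < ε) :
    ∃ k, ∀ t : UnitAddCircle, n • t = 0 →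
      ∃ ξ : G →+ UnitAddCircle, (∀ s ∈ F, ‖ξ s‖ < ε) ∧ ‖ξ (e k) - t‖ < ε := by
  let L := AddSubgroup.closure (F : Set G)
  have _ : AddGroup.FG L := (AddGroup.fg_iff_addSubgroup_fg _).2 ⟨F, rfl⟩
  have hFL : ∀ s ∈ F, s ∈ L := fun s hs => AddSubgroup.subset_closure hs
  have hord : ∀ k (c : ℤ), c • e k ∈ L ↔ (addOrderOf (e k : G ⧸ L) : ℤ) ∣ c := by
    intro k c
    rw [addOrderOf_dvd_iff_zsmul_eq_zero, ← QuotientAddGroup.mk_zsmul,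
      QuotientAddGroup.eq_zero_iff]
  have hvanish : ∀ k (t : UnitAddCircle), (addOrderOf (e k : G ⧸ L) : ℤ) • t = 0 →
      ∃ ξ : G →+ UnitAddCircle, (∀ s ∈ L, ξ s = 0) ∧ ξ (e k) = t := by
    intro k t ht
    refine L.exists_hom_vanishing fun c hc => ?_
    obtain ⟨j, rfl⟩ := (hord k c).1 hc
    rw [mul_comm, mul_smul, ht, smul_zero]
  rcases Nat.eq_zero_or_pos n with rfl | hn
  swap
  · obtain ⟨k, hk⟩ := he.exists_order_eq hn L
    refine ⟨k, fun t ht => ?_⟩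
    obtain ⟨ξ, h1, h2⟩ := hvanish k t (by rw [hk]; exact_mod_cast ht)
    exact ⟨ξ, fun s hs => by simpa [h1 s (hFL s hs)] using hε, by simpa [h2] using hε⟩
  obtain ⟨M, hM⟩ := exists_nat_one_div_lt hε
  by_cases hcase : ∃ k, addOrderOf (e k : G ⧸ L) = 0 ∨ M < addOrderOf (e k : G ⧸ L)
  · obtain ⟨k, hk⟩ := hcase
    refine ⟨k, fun t _ => ?_⟩
    obtain ⟨t', ht', hlt⟩ : ∃ t' : UnitAddCircle,
        (addOrderOf (e k : G ⧸ L) : ℤ) • t' = 0 ∧ ‖t' - t‖ < ε := by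
      rcases hk with hk | hk
      · exact ⟨t, by simp [hk], by simpa using hε⟩
      · obtain ⟨t', h1, h2⟩ := UnitAddCircle.exists_zsmul_eq_zero_near (M.zero_le.trans_lt hk) t
        refine ⟨t', h1, h2.trans_lt (lt_of_le_of_lt ?_ hM)⟩
        gcongr
        exact_mod_cast hk
    obtain ⟨ξ, h1, h2⟩ := hvanish k t' ht'
    exact ⟨ξ, fun s hs => by simpa [h1 s (hFL s hs)] using hε, by rwa [h2]⟩
  · push Not at hcase
    obtain ⟨k, hk⟩ := he.exists_real_hom F M.factorial_pos (fun k => by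
      have := (hord k M.factorial).2 (by
        exact_mod_cast Nat.dvd_factorial (Nat.pos_of_ne_zero (hcase k).1) (hcase k).2)
      exact_mod_cast this) hε
    refine ⟨k, fun t _ => ?_⟩
    obtain ⟨x, hx, rfl⟩ := AddCircle.eq_coe_Ico t
    obtain ⟨α, h1, h2⟩ := hk x hx
    refine ⟨(QuotientAddGroup.mk' _).comp α, fun s hs => ?_, ?_⟩
    · exact (UnitAddCircle.norm_coe_le _).trans_lt (h1 s hs)
    · have : (QuotientAddGroup.mk' (AddSubgroup.zmultiples (1 : ℝ))).comp α (e k) =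
          (x : UnitAddCircle) := by simp [h2]
      rw [this, sub_self, norm_zero]
      exact hε

end Characters

/-! ### The embedding into a power of the circle -/

section DenseEmbedding

open Set

variable {G : Type u} [AddCommGroup G]

/-- The characters of a group, as a subspace of the product space. -/
abbrev CharacterSpace (G : Type u) [AddCommGroup G] : Type u :=
  {f : G → UnitAddCircle // ∀ a b, f (a + b) = f a + f b}

instance CharacterSpace.compactSpace : CompactSpace (CharacterSpace G) := by
  refine isCompact_iff_compactSpace.1
    (IsClosed.isCompact (s := {f : G → UnitAddCircle | ∀ a b, f (a + b) = f a + f b}) ?_)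
  simp only [ofPred_forall]
  exact isClosed_iInter fun a => isClosed_iInter fun b =>
    isClosed_eq (continuous_apply _) ((continuous_apply a).add (continuous_apply b))

theorem CharacterSpace.nsmul_apply (f : CharacterSpace G) (n : ℕ) (a : G) :
    f.1 (n • a) = n • f.1 a :=
  map_nsmul (AddMonoidHom.mk' f.1 f.2) n a

theorem CharacterSpace.exists_basic_subset {U : Set (CharacterSpace G)} (hU : IsOpen U)
    {ψ : CharacterSpace G} (hψ : ψ ∈ U) : ∃ (F : Finset G) (ε : ℝ), 0 < ε ∧
      ∀ f : CharacterSpace G, (∀ s ∈ F, ‖f.1 s - ψ.1 s‖ < ε) → f ∈ U := by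
  obtain ⟨O, hO, rfl⟩ := isOpen_induced_iff.1 hU
  obtain ⟨F, V, hV, hVO⟩ := isOpen_pi_iff.1 hO ψ.1 hψ
  have : ∀ s ∈ F, ∀ᶠ ε in 𝓝[>] (0 : ℝ), Metric.ball (ψ.1 s) ε ⊆ V s := by
    intro s hs
    obtain ⟨ε, hε, hsub⟩ := Metric.isOpen_iff.1 (hV s hs).1 _ (hV s hs).2
    filter_upwards [Ioo_mem_nhdsGT hε] with δ hδ
    exact (Metric.ball_subset_ball hδ.2.le).trans hsub
  obtain ⟨ε, hε, hε0⟩ := (((Filter.eventually_all_finset F).2 this).and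
    (self_mem_nhdsWithin : Ioi (0 : ℝ) ∈ 𝓝[>] 0)).exists
  refine ⟨F, ε, hε0, fun f hf => hVO fun s hs => hε s hs ?_⟩
  rw [Metric.mem_ball, dist_eq_norm]
  exact hf s hs

/-- Pick ψ in each U and t in each V. Adding to ψ a character small on the finite set defining the
neighbourhood, with value near t - ψ(e_k) at e_k, stays in U and lands in V. -/
theorem IsDispersed.hasFiniteHitting {n : ℕ} {e : ℕ → G} (he : IsDispersed n e) :
    HasFiniteHitting fun (k : ℕ) (f : CharacterSpace G) =>
      (⟨f.1 (e k), by rw [← f.nsmul_apply, he.nsmul_eq_zero]; simpa using f.nsmul_apply 0 0⟩ :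
        {t : UnitAddCircle // n • t = 0}) := by
  classical
  intro A hA hAo
  have h1 : ∀ a : Set (CharacterSpace G) × Set {t : UnitAddCircle // n • t = 0},
      ∃ (ψ : CharacterSpace G) (t : {t : UnitAddCircle // n • t = 0}) (F : Finset G) (ε : ℝ),
        a ∈ A → 0 < ε ∧ (∀ f : CharacterSpace G, (∀ s ∈ F, ‖f.1 s - ψ.1 s‖ < ε) → f ∈ a.1) ∧
          ∀ t', ‖t'.1 - t.1‖ < ε → t' ∈ a.2 := by
    intro a
    by_cases ha : a ∈ A
    · obtain ⟨hU, ⟨ψ, hψ⟩, hV, ⟨t, ht⟩⟩ := hAo a ha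
      obtain ⟨F, ε, hε, h⟩ := CharacterSpace.exists_basic_subset hU hψ
      obtain ⟨δ, hδ, h'⟩ := Metric.isOpen_iff.1 hV t ht
      refine ⟨ψ, t, F, min ε δ, fun _ => ⟨lt_min hε hδ, fun f hf => h f fun s hs =>
        (hf s hs).trans_le (min_le_left _ _), fun t' ht' => h' ?_⟩⟩
      rw [Metric.mem_ball, Subtype.dist_eq, dist_eq_norm]
      exact ht'.trans_le (min_le_right _ _)
    · exact ⟨⟨0, by simp⟩, ⟨0, by simp⟩, ∅, 1, fun h => absurd h ha⟩
  choose ψ t F ε h using h1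
  obtain ⟨δ, hδ, hδ0⟩ : ∃ δ : ℝ, (∀ a ∈ A, δ < ε a) ∧ 0 < δ := by
    have : ∀ a ∈ A, ∀ᶠ δ in 𝓝[>] (0 : ℝ), δ < ε a := fun a ha => by
      filter_upwards [Ioo_mem_nhdsGT (h a ha).1] with δ hδ
      exact hδ.2
    exact (((Filter.eventually_all_finite hA).2 this).and self_mem_nhdsWithin).exists
  obtain ⟨k, hk⟩ := he.exists_small_character (hA.toFinset.biUnion F) hδ0
  refine ⟨k, fun a ha => ?_⟩
  obtain ⟨ξ, hξ1, hξ2⟩ := hk ((t a).1 - (ψ a).1 (e k)) (by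
    rw [smul_sub, (t a).2, ← (ψ a).nsmul_apply, he.nsmul_eq_zero]
    simpa using (ψ a).nsmul_apply 0 0)
  refine ⟨⟨fun s => (ψ a).1 s + ξ s, fun b c => ?_⟩, (h a ha).2.1 _ fun s hs => ?_,
    (h a ha).2.2 _ ?_⟩
  · change (ψ a).1 (b + c) + ξ (b + c) = _
    rw [(ψ a).2, map_add, add_add_add_comm]
  · simpa using (hξ1 s (Finset.mem_biUnion.2 ⟨a, hA.mem_toFinset.2 ha, hs⟩)).trans (hδ a ha)
  · have := hξ2.trans (hδ a ha)
    rwa [← sub_add, sub_add_eq_add_sub, add_comm] at this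

theorem exists_character_ne_zero {s : G} (hs : s ≠ 0) : ∃ ξ : G →+ UnitAddCircle, ξ s ≠ 0 := by
  obtain ⟨t, ht⟩ := UnitAddCircle.exists_addOrderOf_eq (addOrderOf s)
  obtain ⟨ξ, hξ⟩ := exists_hom_apply_eq (x := s) (t := t) fun c hc => by
    rwa [← addOrderOf_dvd_iff_zsmul_eq_zero, ht, addOrderOf_dvd_iff_zsmul_eq_zero]
  refine ⟨ξ, fun h => hs ?_⟩
  rw [hξ] at h
  rwa [h, addOrderOf_zero, eq_comm, AddMonoid.addOrderOf_eq_one_iff] at ht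

/-- An index set with the cardinality of the continuum. -/
abbrev ContinuumIndex : Type u := ULift.{u} (ℕ × (ℕ → Bool))

theorem exists_dense_hom {n : ℕ} {ι : Type*} [Countable ι] {e : ι → ℕ → G}
    (he : ∀ i, IsDispersed n (e i)) {S : Set G} (hS : S.Countable) :
    ∃ π : G →+ (ContinuumIndex.{u} → UnitAddCircle), (∀ s ∈ S, π s = 0 → s = 0) ∧
      ∀ i z, n • z = 0 → z ∈ closure (range fun k => π (e i k)) := by
  obtain ⟨𝓑, h𝓑, hbasis, hclopen, hcompact⟩ := exists_countable_compact_clopen_basis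
  obtain ⟨s, hs⟩ : ∃ s : ℕ → G, S ⊆ range s := by
    rcases S.eq_empty_or_nonempty with rfl | hne
    · exact ⟨0, empty_subset _⟩
    · obtain ⟨s, hs⟩ := hS.exists_eq_range hne
      exact ⟨s, hs.le⟩
  have hN : ∀ j, ∃ N : Set (CharacterSpace G), IsClosed N ∧ (interior N).Nonempty ∧
      ∀ f ∈ N, f.1 (s j) = 0 → s j = 0 := by
    intro j
    by_cases hj : s j = 0
    · exact ⟨univ, isClosed_univ, ⟨⟨0, by simp⟩, by simp⟩, fun _ _ _ => hj⟩
    · obtain ⟨ξ, hξ⟩ := exists_character_ne_zero hj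
      have hopen : IsOpen {f : CharacterSpace G | f.1 (s j) ≠ 0} :=
        isOpen_ne_fun ((continuous_apply _).comp continuous_subtype_val) continuous_const
      obtain ⟨N, hN, hNc, hNs⟩ := exists_mem_nhds_isClosed_subset
        (hopen.mem_nhds (x := ⟨ξ, map_add ξ⟩) hξ)
      exact ⟨N, hNc, ⟨_, mem_interior_iff_mem_nhds.2 hN⟩, fun f hf h => absurd h (hNs hf)⟩
  choose N hNc hNi hNs using hN
  -- The ℕ-factor of the index takes care of injectivity on S: characters with first index j start
  -- in N j, so they do not kill s j unless it is 0.
  have hK : ClosedFamily fun x : ℕ × (ℕ → Bool) => N x.1 :=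
    ⟨(IsLocallyConstant.of_discrete N).comp_continuous continuous_fst,
      fun x => hNc x.1, fun x => hNi x.1⟩
  have _ : Nonempty {t : UnitAddCircle // n • t = 0} := ⟨⟨0, by simp⟩⟩
  obtain ⟨y, hy, hdense⟩ := hK.exists_dense_selection h𝓑 hbasis hclopen hcompact
    (fun i k => Continuous.subtype_mk
      ((continuous_apply (e i k)).comp continuous_subtype_val) _)
    (fun i => (he i).hasFiniteHitting)
  refine ⟨AddMonoidHom.mk' (fun g x => (y x.down).1 g) fun a b => funext fun x =>
    (y x.down).2 a b, ?_, ?_⟩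
  · intro a ha h0
    obtain ⟨j, rfl⟩ := hs ha
    exact hNs j _ (hy (j, fun _ => false)) (congrFun h0 ⟨(j, fun _ => false)⟩)
  · intro i z hz
    let h : (ℕ × (ℕ → Bool) → {t : UnitAddCircle // n • t = 0}) →
      ContinuumIndex.{u} → UnitAddCircle := fun w x => (w x.down).1
    have hh : Continuous h := continuous_pi fun x =>
      continuous_subtype_val.comp (continuous_apply x.down)
    have := map_mem_closure hh (hdense i fun x => ⟨z ⟨x⟩, congrFun hz ⟨x⟩⟩)
      (t := range fun k => fun x : ContinuumIndex.{u} => (y x.down).1 (e i k))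
      (by rintro _ ⟨k, rfl⟩; exact ⟨k, rfl⟩)
    exact this

theorem mk_set_continuumIndex :
    Cardinal.mk (Set ContinuumIndex.{u}) = 2 ^ Cardinal.continuum.{u} := by
  rw [Cardinal.mk_set, Cardinal.mk_uLift]
  simp

theorem exists_dense_embedding (hG : Cardinal.mk G ≤ 2 ^ Cardinal.continuum.{u}) {n : ℕ}
    {ι : Type*} [Countable ι] {e : ι → ℕ → G} (he : ∀ i, IsDispersed n (e i)) :
    ∃ π : G →+ (ContinuumIndex.{u} → UnitAddCircle), Function.Injective π ∧
      ∀ i z, n • z = 0 → z ∈ closure (range fun k => π (e i k)) := by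
  let S : AddSubgroup G := AddSubgroup.closure (⋃ i, range (e i))
  have hS : (S : Set G).Countable := by
    refine Cardinal.le_aleph0_iff_set_countable.1 ((AddSubgroup.cardinalMk_closure_le _).trans ?_)
    refine max_le (Cardinal.le_aleph0_iff_set_countable.2 ?_) le_rfl
    exact countable_iUnion fun i => countable_range _
  obtain ⟨π₀, hinj, hdense⟩ := exists_dense_hom he hS
  let Γ : AddSubgroup (G × (ContinuumIndex.{u} → UnitAddCircle)) :=
    S.map ((AddMonoidHom.id G).prod π₀)
  have hΓ : Γ.IsBiinjective := by
    rintro _ ⟨s, hs, rfl⟩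
    refine ⟨fun h => ?_, fun h => hinj s hs h⟩
    have h' : s = 0 := h
    simp [h']
  obtain ⟨π, hπ, hext⟩ := exists_injective_extension (hG.trans_eq mk_set_continuumIndex.symm) hΓ
    (hS.image _)
  refine ⟨π, hπ, fun i z hz => ?_⟩
  have : ∀ k, π (e i k) = π₀ (e i k) := fun k =>
    hext _ ⟨e i k, AddSubgroup.subset_closure (mem_iUnion.2 ⟨i, k, rfl⟩), rfl⟩
  simp only [this]
  exact hdense i z hz

end DenseEmbedding

/-! ### Dispersed sequences from Zariski density, and the conclusion -/

section ZariskiDense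

open Set
open scoped Pointwise

variable {G : Type u} [AddCommGroup G]

theorem exists_minimal_finiteIndex_torsion (G : Type u) [AddCommGroup G] :
    ∃ n : ℕ, (nsmulAddMonoidHom (α := G) n).ker.FiniteIndex ∧
      ∀ d, 0 < d → d ∣ n → d ≠ n → ¬ (nsmulAddMonoidHom (α := G) d).ker.FiniteIndex := by
  classical
  by_cases h : ∃ n, 0 < n ∧ (nsmulAddMonoidHom (α := G) n).ker.FiniteIndex
  · refine ⟨Nat.find h, (Nat.find_spec h).2, fun d hd hdvd hne hfin => ?_⟩
    exact Nat.find_min h ((Nat.le_of_dvd (Nat.find_spec h).1 hdvd).lt_of_ne hne) ⟨hd, hfin⟩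
  · refine ⟨0, ?_, fun d hd _ _ hfin => h ⟨d, hd, hfin⟩⟩
    have : (nsmulAddMonoidHom (α := G) 0).ker = ⊤ := by
      ext x
      simp
    rw [this]
    infer_instance

theorem isElementaryAlgebraicSet_vadd_ker (g : G) (n : ℕ) :
    IsElementaryAlgebraicSet (g +ᵥ ((nsmulAddMonoidHom (α := G) n).ker : Set G)) :=
  ⟨g, n, rfl⟩

theorem mem_vadd_ker_nsmul {g x : G} {n : ℕ} :
    x ∈ g +ᵥ ((nsmulAddMonoidHom (α := G) n).ker : Set G) ↔ n • x = n • g := by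
  rw [mem_vadd_set_iff_neg_vadd_mem, SetLike.mem_coe, AddMonoidHom.mem_ker]
  change n • (-g + x) = 0 ↔ _
  rw [smul_add, smul_neg, neg_add_eq_zero, eq_comm]

/-- Otherwise X, hence G, is covered by the cosets of G[n] other than g + G[n] together with
finitely many cosets of subgroups of infinite index. By Neumann's lemma the latter can be dropped,
leaving g uncovered. -/
theorem IsZariskiDense.exists_avoiding {X : Set G} (hX : IsZariskiDense X) {n : ℕ}
    (hn : (nsmulAddMonoidHom (α := G) n).ker.FiniteIndex) (g : G) (P : Finset (G × ℕ))
    (hP : ∀ p ∈ P, ¬ (nsmulAddMonoidHom (α := G) p.2).ker.FiniteIndex) :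
    ∃ x, n • x = 0 ∧ g + x ∈ X ∧ ∀ p ∈ P, p.2 • x ≠ p.2 • p.1 := by
  classical
  by_contra! hcon
  let N := (nsmulAddMonoidHom (α := G) n).ker
  have _ : Finite (G ⧸ N) := AddSubgroup.finite_quotient_of_finiteIndex
  have _ := Fintype.ofFinite (G ⧸ N)
  let s : Finset ((G ⧸ N) ⊕ (G × ℕ)) := (Finset.univ.erase (g : G ⧸ N)).disjSum P
  let m : (G ⧸ N) ⊕ (G × ℕ) → ℕ := Sum.elim (fun _ => n) Prod.snd
  let c : (G ⧸ N) ⊕ (G × ℕ) → G := Sum.elim Quotient.out fun p => g + p.1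
  have hcover : ⋃ i ∈ s, c i +ᵥ ((nsmulAddMonoidHom (α := G) (m i)).ker : Set G) = univ := by
    refine isZariskiDense_iff.1 hX _
      ⟨(fun i => c i +ᵥ ((nsmulAddMonoidHom (α := G) (m i)).ker : Set G)) '' s,
        s.finite_toSet.image _, ?_, (sUnion_image _ _).symm⟩ fun x hx => ?_
    · rintro _ ⟨i, -, rfl⟩
      exact isElementaryAlgebraicSet_vadd_ker _ _
    · by_cases hxg : (x : G ⧸ N) = g
      · have hmem : n • (x - g) = 0 := by
          rw [eq_comm, QuotientAddGroup.eq] at hxg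
          rw [sub_eq_neg_add]
          exact hxg
        obtain ⟨p, hp, hpx⟩ := hcon (x - g) hmem (by rwa [add_sub_cancel])
        refine mem_iUnion₂.2 ⟨Sum.inr p, Finset.inr_mem_disjSum.2 hp, ?_⟩
        rw [mem_vadd_ker_nsmul]
        change p.2 • x = p.2 • (g + p.1)
        rw [smul_add, ← hpx, smul_sub, add_sub_cancel]
      · refine mem_iUnion₂.2 ⟨Sum.inl (x : G ⧸ N), Finset.inl_mem_disjSum.2
          (Finset.mem_erase.2 ⟨hxg, Finset.mem_univ _⟩), ?_⟩
        rw [mem_vadd_set_iff_neg_vadd_mem]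
        exact QuotientAddGroup.eq.1 (Quotient.out_eq' (x : G ⧸ N))
  have hg := (AddSubgroup.leftCoset_cover_filter_FiniteIndex hcover).symm ▸ mem_univ g
  obtain ⟨i, hi, hgi⟩ := mem_iUnion₂.1 hg
  obtain ⟨his, hfin⟩ := Finset.mem_filter.1 hi
  rcases i with q | p
  · refine Finset.ne_of_mem_erase (Finset.inl_mem_disjSum.1 his) ?_
    rw [mem_vadd_set_iff_neg_vadd_mem] at hgi
    rw [← Quotient.out_eq' q]
    exact QuotientAddGroup.eq.2 hgi
  · exact hP p (Finset.inr_mem_disjSum.1 his) hfin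

theorem IsZariskiDense.exists_isDispersed {X : Set G} (hX : IsZariskiDense X) {n : ℕ}
    (hn : (nsmulAddMonoidHom (α := G) n).ker.FiniteIndex)
    (hd : ∀ d, 0 < d → d ∣ n → d ≠ n → ¬ (nsmulAddMonoidHom (α := G) d).ker.FiniteIndex) (g : G) :
    ∃ e : ℕ → G, IsDispersed n e ∧ ∀ k, g + e k ∈ X := by
  classical
  obtain ⟨f, hf, hf'⟩ := exists_seq_of_forall_finset_exists
    (fun p : ℕ × G => n • p.2 = 0 ∧ g + p.2 ∈ X)
    -- The first components count stages. Only divisors up to the current stage are treated, since n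
    -- = 0 has infinitely many; for fixed d, collisions then involve no two indices both at least d.
    (fun p q => p.1 < q.1 ∧ ∀ d, 0 < d → d ∣ n → d ≠ n → d ≤ q.1 → d • q.2 ≠ d • p.2) (by
      intro s _
      let K := s.sup Prod.fst + 1
      obtain ⟨x, hx0, hxX, hx⟩ := hX.exists_avoiding hn g
        ((s.image Prod.snd) ×ˢ (Finset.Icc 1 K).filter fun d => d ∣ n ∧ d ≠ n) (by
          intro p hp
          simp only [Finset.mem_product, Finset.mem_filter, Finset.mem_Icc] at hp
          exact hd _ hp.2.1.1 hp.2.2.1 hp.2.2.2)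
      refine ⟨(K, x), ⟨hx0, hxX⟩, fun p hp => ⟨Nat.lt_succ_of_le (Finset.le_sup hp), ?_⟩⟩
      intro d h0 hdvd hne hdK
      exact hx (p.2, d) (Finset.mem_product.2 ⟨Finset.mem_image_of_mem _ hp,
        Finset.mem_filter.2 ⟨Finset.mem_Icc.2 ⟨h0, hdK⟩, hdvd, hne⟩⟩))
  have hmono : StrictMono fun k => (f k).1 := fun i j hij => (hf' i j hij).1
  refine ⟨fun k => (f k).2, ⟨fun k => (hf k).1, fun d h0 hdvd hne h => ?_⟩, fun k => (hf k).2⟩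
  have hsub : ({k | d • (f k).2 = h} ∩ Ici d).Subsingleton := by
    have aux : ∀ i j, d ≤ j → i < j → d • (f j).2 ≠ d • (f i).2 := fun i j hj hij =>
      (hf' i j hij).2 d h0 hdvd hne (hj.trans (hmono.le_apply))
    rintro i ⟨hi, hdi⟩ j ⟨hj, hdj⟩
    rcases lt_trichotomy i j with hij | hij | hij
    · exact absurd (hj.trans hi.symm) (aux i j hdj hij)
    · exact hij
    · exact absurd (hi.trans hj.symm) (aux j i hdi hij)
  refine (hsub.finite.union (finite_Iio d)).subset fun k hk => ?_
  rcases lt_or_ge k d with hkd | hkd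
  · exact Or.inr hkd
  · exact Or.inl ⟨hk, hkd⟩

theorem IsZariskiDense.exists_precompact {X : Set G} (hX : IsZariskiDense X)
    (hG : Cardinal.mk G ≤ 2 ^ Cardinal.continuum.{u}) :
    ∃ (_ : TopologicalSpace G) (_ : IsTopologicalAddGroup G),
        T2Space G ∧ IsPrecompactGroup G ∧ Dense X := by
  obtain ⟨n, hn, hd⟩ := exists_minimal_finiteIndex_torsion G
  let N := (nsmulAddMonoidHom (α := G) n).ker
  have _ : Finite (G ⧸ N) := AddSubgroup.finite_quotient_of_finiteIndex
  choose e he heX using fun q : G ⧸ N => hX.exists_isDispersed hn hd q.out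
  obtain ⟨π, hπ, hdense⟩ := exists_dense_embedding hG he
  refine isPrecompactGroup_of_injective π hπ fun g => ?_
  -- The point g differs from its coset representative by an element of G[n], whose image is a limit
  -- of the π(e_k) for that coset; translating back gives a limit of points of π(X).
  let q : G ⧸ N := g
  have hq : n • (-q.out + g) = 0 := QuotientAddGroup.eq.1 (Quotient.out_eq' q)
  have hcl := hdense q (π (-q.out + g)) (by rw [← map_nsmul, hq, map_zero])
  have := map_mem_closure (t := π '' X) (continuous_const_add (π q.out)) hcl (by
    rintro _ ⟨k, rfl⟩
    exact ⟨_, heX q k, map_add _ _ _⟩)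
  rwa [← map_add, add_neg_cancel_left] at this

end ZariskiDense

theorem mainTheorem7 (G : Type u) [AddCommGroup G]
    (hG : Cardinal.mk G ≤ 2 ^ Cardinal.continuum.{u}) (X : Set G) :
    List.TFAE [
      IsPotentiallyDense X,
      ∃ (_ : TopologicalSpace G) (_ : IsTopologicalAddGroup G),
        T2Space G ∧ IsPrecompactGroup G ∧ Dense X,
      IsZariskiDense X] := by
  tfae_have 1 → 3 := IsPotentiallyDense.isZariskiDense
  tfae_have 3 → 2 := fun h => h.exists_precompact hG
  tfae_have 2 → 1 := fun ⟨τ, hτ, hT2, _, hX⟩ => ⟨τ, hτ, hT2, hX⟩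
  tfae_finish
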